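/- For an ordered set $X$ and an ordinal $\beta$, let $[X]^{\beta}$ denote the collection of subsets of $X$ of order type $\beta$. For ordinals $\alpha,\beta_0,\beta_1$, the relation $\alpha\to(\beta_0,\beta_1)^2$ means that for every colouring $f:[\alpha]^2\to\{0,1\}$ there are $i\in\{0,1\}$ and $X\in[\alpha]^{\beta_i}$ such that $f$ is constant with value $i$ on $[X]^2$; its negation is written $\alpha\not\to(\beta_0,\beta_1)^2$. For an infinite cardinal $\kappa$, the dominating number $\mathfrak d_\kappa$ is the least cardinality of a family $A$ of functions $\kappa\to\kappa$ such that for every $f:\kappa\to\kappa$ there is $g\in A$ with $|\{\xi<\kappa : g(\xi)<f(\xi)\}|<\kappa$. Let $\kappa$ be a regular (infinite) cardinal and let $\lambda=\kappa^+$. If $\mathfrak d_\kappa=\lambda$, then $$\alpha\not\to(\lambda\kappa,4)^2\qquad\text{for every ordinal }\alpha<\lambda^2\kappa,$$ where $\lambda\kappa$ and $\lambda^2\kappa$ denote ordinal products and power (so $\lambda\kappa$ is the order type of $\kappa$ consecutive copies of $\lambda$). -/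

import Mathlib

open scoped Ordinal Cardinal

universe u v

/-- The dominating number `𝔡_κ`: the least cardinality of a family `A` of functions from `κ` to `κ`
such that for every `f : κ → κ` some `g ∈ A` satisfies `|{ξ < κ : g ξ < f ξ}| < κ`.
The cardinal `κ` is identified with its initial ordinal `κ.ord`. -/
noncomputable def dominatingNumber (κ : Cardinal.{u}) : Cardinal.{u} :=
  sInf {c : Cardinal.{u} | ∃ A : Set (κ.ord.ToType → κ.ord.ToType), #A = c ∧
    ∀ f : κ.ord.ToType → κ.ord.ToType, ∃ g ∈ A, #{ξ : κ.ord.ToType | g ξ < f ξ} < κ}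

/-- `[X]^k`: the collection of the subsets of the well-ordered set `X` of order type `k`. -/
def subsetsOfType {W : Type u} [LinearOrder W] [WellFoundedLT W] (X : Set W) (k : Ordinal.{u}) :
    Set (Set W) :=
  {s | s ⊆ X ∧ typeLT s = k}

/-- The partition relation `α → (β i : i ∈ ι)^k`: for every colouring `f : [α]^k → ι` there are a
colour `i` and a set `X ∈ [α]^(β i)` all of whose subsets of order type `k` get colour `i`. -/
def PartitionArrow {ι : Type v} (α : Ordinal.{u}) (β : ι → Ordinal.{u}) (k : Ordinal.{u}) : Prop :=
  ∀ f : subsetsOfType (Set.univ : Set α.ToType) k → ι,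
    ∃ i : ι, ∃ X ∈ subsetsOfType (Set.univ : Set α.ToType) (β i),
      ∀ s : subsetsOfType (Set.univ : Set α.ToType) k, s.1 ∈ subsetsOfType X k → f s = i

open Set

/-! Since `α < λ²κ`, `α` embeds as a proper initial segment of `κ` copies of `W × W`, where `W` has
type `λ`, so it meets fewer than `κ` copies. Pairs get colour 1 when they lie in one copy and form a
`ScaleEdge`; such edges run to a later column and a lower height.

The graph is controlled by a subadditive `v : [λ]² → κ` with small sublevels
(`exists_isSubadditive`). Each neighbourhood `guess` omits the heights that would create a triangle
whose later two columns have the wrong order of `v`-values. The surviving triangles compare values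
of `v` in ways that contradict each other on four points (`IsSubadditive.not_clique_four`).

By pigeonhole (`exists_columns`), a set of type `λκ` has `κ` columns with `λ` points each in a
single copy. A dominating family of size `λ` can be indexed by heights, so a high enough point can
use the index `j` of a function dominating the one that locates suitable points in the other
columns. This yields an edge (`IsSubadditive.exists_scaleEdge`). -/

/-- The well-order `K` has the order type of the initial ordinal of the regular cardinal `κ`. -/
structure HasRegularType (κ : Cardinal.{u}) (K : Type u) [LinearOrder K] : Prop where
  isRegular : κ.IsRegular
  mk_eq : #K = κ
  mk_Iio_lt : ∀ k : K, #(Iio k) < κ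
  exists_gt : ∀ s : Set K, #s < κ → ∃ k, ∀ x ∈ s, x < k

theorem hasRegularType_toType {κ : Cardinal.{u}} (hκ : κ.IsRegular) :
    HasRegularType κ κ.ord.ToType where
  isRegular := hκ
  mk_eq := by simp
  mk_Iio_lt k := by simpa using Cardinal.mk_Iio_lt k (by simp)
  exists_gt s hs := by
    by_contra! h
    have h1 : IsCofinal s := fun k => h k
    have h2 := Order.cof_le h1
    rw [Ordinal.cof_toType, hκ.cof_ord] at h2
    exact absurd hs (not_lt.mpr h2)

section Small

variable {κ : Cardinal.{u}} {α β : Type u}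

theorem mk_biUnion_lt_of_isRegular (hκ : κ.IsRegular) {s : Set α} (hs : #s < κ)
    {t : α → Set β} (ht : ∀ a ∈ s, #(t a) < κ) : #(⋃ a ∈ s, t a : Set β) < κ :=
  (Cardinal.card_biUnion_lt_iff_forall_of_isRegular (t := fun a _ => t a) hκ hs).2 ht

theorem mk_lt_of_subset {s t : Set α} (hst : s ⊆ t) (ht : #t < κ) : #s < κ :=
  (Cardinal.mk_le_mk_of_subset hst).trans_lt ht

theorem mk_union_lt_of_isRegular (hκ : κ.IsRegular) {s t : Set α} (hs : #s < κ) (ht : #t < κ) :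
    #(s ∪ t : Set α) < κ :=
  (Cardinal.mk_union_le s t).trans_lt (Cardinal.add_lt_of_lt hκ.aleph0_le hs ht)

theorem mk_singleton_lt_of_isRegular (hκ : κ.IsRegular) (a : α) : #({a} : Set α) < κ := by
  rw [Cardinal.mk_singleton]; exact_mod_cast hκ.nat_lt 1

theorem mk_image_lt {s : Set α} (hs : #s < κ) (f : α → β) : #(f '' s) < κ :=
  Cardinal.mk_image_le.trans_lt hs

theorem exists_mem_notMem_of_mk_lt {s t : Set α} (hs : #s < κ) (ht : κ ≤ #t) :
    ∃ x ∈ t, x ∉ s := by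
  by_contra! h
  exact absurd (mk_lt_of_subset (fun x hx => h x hx) hs) (not_lt.mpr ht)

theorem HasRegularType.mk_Iic_lt {K : Type u} [LinearOrder K] (hK : HasRegularType κ K) (k : K) :
    #(Iic k) < κ := by
  rw [← Iio_union_right]
  exact mk_union_lt_of_isRegular hK.isRegular (hK.mk_Iio_lt k)
    (mk_singleton_lt_of_isRegular hK.isRegular k)

end Small

/-! ### Subadditive functions on `[κ⁺]²` from increasing tree orders -/

section Subadditive

variable {κ : Cardinal.{u}} {K W : Type u} [LinearOrder K] [LinearOrder W] [WellFoundedLT W]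

/-- The predecessors of `β` in the `ν`-th of an increasing sequence of tree orders on `W`, built from
enumerations `e β` of the initial segments. -/
def treeBelow {K W : Type u} [LinearOrder K] [LinearOrder W] [WellFoundedLT W] (e : W → W → K) (β : W) (ν : K) : Set W :=
  {α | ∃ ξ, ∃ _ : ξ < β, e β ξ ≤ ν ∧
    (∀ η ζ, ∀ _ : ζ < β, η < ζ → e β η ≤ e β ξ → e β ζ ≤ e β ξ → η ∈ treeBelow e ζ ν) ∧
    (α = ξ ∨ α ∈ treeBelow e ξ ν)}
termination_by (wellFounded_lt (α := W)).wrap β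
decreasing_by all_goals assumption

theorem mem_treeBelow {e : W → W → K} {α β : W} {ν : K} :
    α ∈ treeBelow e β ν ↔ ∃ ξ < β, e β ξ ≤ ν ∧
    (∀ η ζ, ζ < β → η < ζ → e β η ≤ e β ξ → e β ζ ≤ e β ξ → η ∈ treeBelow e ζ ν) ∧
    (α = ξ ∨ α ∈ treeBelow e ξ ν) := by
  rw [treeBelow]
  simp only [mem_ofPred_eq, exists_prop]

theorem lt_of_mem_treeBelow {e : W → W → K} {ν : K} {β : W} :
    ∀ {α}, α ∈ treeBelow e β ν → α < β := by
  induction β using WellFoundedLT.induction with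
  | _ β ih =>
    intro α h
    obtain ⟨ξ, hξ, -, -, rfl | h⟩ := mem_treeBelow.1 h
    · exact hξ
    · exact (ih ξ hξ h).trans hξ

theorem treeBelow_mono {e : W → W → K} {ν ν' : K} (hν : ν ≤ ν') (β : W) :
    treeBelow e β ν ⊆ treeBelow e β ν' := by
  induction β using WellFoundedLT.induction with
  | _ β ih =>
    intro α h
    obtain ⟨ξ, hξ, h1, h2, h3⟩ := mem_treeBelow.1 h
    exact mem_treeBelow.2 ⟨ξ, hξ, h1.trans hν,
      fun η ζ hζ hη h4 h5 => ih ζ hζ (h2 η ζ hζ hη h4 h5), h3.imp_right fun h => ih ξ hξ h⟩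

/-- This gives both transitivity and the tree property of the `ν`-th order; they become the two
subadditivity inequalities. -/
theorem mem_treeBelow_iff_of_mem {e : W → W → K} {ν : K} {β : W} :
    ∀ {γ}, γ ∈ treeBelow e β ν → ∀ {α}, α < γ → (α ∈ treeBelow e β ν ↔ α ∈ treeBelow e γ ν) := by
  induction β using WellFoundedLT.induction with
  | _ β ih =>
    intro γ hγ α hαγ
    have key : ∀ ξ < β, ∀ α γ, α < γ → (γ = ξ ∨ γ ∈ treeBelow e ξ ν) →
        (α ∈ treeBelow e ξ ν ↔ α ∈ treeBelow e γ ν) := by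
      rintro ξ hξ α γ h (rfl | h1)
      · rfl
      · exact ih ξ hξ h1 h
    obtain ⟨ξ, hξ, h1, h2, h3⟩ := mem_treeBelow.1 hγ
    constructor
    · intro hα
      obtain ⟨ξ', hξ', h1', h2', h3'⟩ := mem_treeBelow.1 hα
      have same : ∀ ζ < β, (γ = ζ ∨ γ ∈ treeBelow e ζ ν) → (α = ζ ∨ α ∈ treeBelow e ζ ν) →
          α ∈ treeBelow e γ ν := by
        intro ζ hζ hγζ hαζ
        rw [← key ζ hζ α γ hαγ hγζ]
        refine hαζ.resolve_left ?_
        rintro rfl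
        rcases hγζ with rfl | h
        · exact lt_irrefl _ hαγ
        · exact lt_asymm hαγ (lt_of_mem_treeBelow h)
      have lift : ∀ ζ ζ' x, ζ' < β → ζ ∈ treeBelow e ζ' ν → (x = ζ ∨ x ∈ treeBelow e ζ ν) →
          (x = ζ' ∨ x ∈ treeBelow e ζ' ν) := by
        rintro ζ ζ' x hζ' h (rfl | h4)
        · exact Or.inr h
        · exact Or.inr ((ih ζ' hζ' h (lt_of_mem_treeBelow h4)).2 h4)
      -- Whichever of `ξ`, `ξ'` comes later in the enumeration `e β` has a coherence condition
      -- covering both.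
      have chain : ξ = ξ' ∨ ξ ∈ treeBelow e ξ' ν ∨ ξ' ∈ treeBelow e ξ ν := by
        rcases lt_trichotomy ξ ξ' with h | h | h
        · right; left
          rcases le_total (e β ξ) (e β ξ') with h' | h'
          · exact h2' _ _ hξ' h h' le_rfl
          · exact h2 _ _ hξ' h le_rfl h'
        · exact Or.inl h
        · right; right
          rcases le_total (e β ξ) (e β ξ') with h' | h'
          · exact h2' _ _ hξ h le_rfl h'
          · exact h2 _ _ hξ h h' le_rfl
      rcases chain with rfl | h | h
      · exact same ξ hξ h3 h3'
      · exact same ξ' hξ' (lift ξ ξ' γ hξ' h h3) h3'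
      · exact same ξ hξ h3 (lift ξ' ξ α hξ h h3')
    · intro hα
      exact mem_treeBelow.2 ⟨ξ, hξ, h1, h2, Or.inr ((key ξ hξ α γ hαγ h3).2 hα)⟩

theorem mk_treeBelow_lt (hK : HasRegularType κ K) {e : W → W → K}
    (he : ∀ β, InjOn (e β) (Iio β)) (ν : K) (β : W) : #(treeBelow e β ν) < κ := by
  induction β using WellFoundedLT.induction with
  | _ β ih =>
    have h1 : #{ξ | ξ < β ∧ e β ξ ≤ ν} < κ := by
      refine lt_of_le_of_lt ?_ (hK.mk_Iic_lt ν)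
      have hinj : InjOn (e β) {ξ | ξ < β ∧ e β ξ ≤ ν} := (he β).mono fun ξ hξ => hξ.1
      rw [← Cardinal.mk_image_eq_of_injOn _ _ hinj]
      refine Cardinal.mk_le_mk_of_subset ?_
      rintro _ ⟨ξ, hξ, rfl⟩
      exact hξ.2
    refine mk_lt_of_subset (t := ⋃ ξ ∈ {ξ | ξ < β ∧ e β ξ ≤ ν}, ({ξ} ∪ treeBelow e ξ ν)) ?_
      (mk_biUnion_lt_of_isRegular hK.isRegular h1 fun ξ hξ =>
        mk_union_lt_of_isRegular hK.isRegular (mk_singleton_lt_of_isRegular hK.isRegular ξ)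
          (ih ξ hξ.1))
    intro α hα
    obtain ⟨ξ, hξ, h2, -, h3⟩ := mem_treeBelow.1 hα
    simp only [mem_iUnion]
    exact ⟨ξ, ⟨hξ, h2⟩, h3⟩

/-- Coherence at `α` concerns only the fewer than `κ` points enumerated no later than `α`, so by
regularity one `ν` serves all pairs of them. -/
theorem exists_mem_treeBelow (hK : HasRegularType κ K) {e : W → W → K}
    (he : ∀ β, InjOn (e β) (Iio β)) {β : W} : ∀ {α}, α < β → ∃ ν, α ∈ treeBelow e β ν := by
  induction β using WellFoundedLT.induction with
  | _ β ih =>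
    intro α hα
    have : ∀ η ζ, ∃ ν, ζ < β → η < ζ → η ∈ treeBelow e ζ ν := by
      intro η ζ
      by_cases h : ζ < β ∧ η < ζ
      · obtain ⟨ν, hν⟩ := ih ζ h.1 h.2
        exact ⟨ν, fun _ _ => hν⟩
      · exact ⟨e β α, fun h1 h2 => absurd ⟨h1, h2⟩ h⟩
    choose N hN using this
    let s : Set W := {ξ | ξ < β ∧ e β ξ ≤ e β α}
    have hs : #s < κ := by
      refine lt_of_le_of_lt ?_ (hK.mk_Iic_lt (e β α))
      have hinj : InjOn (e β) s := (he β).mono fun ξ hξ => hξ.1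
      rw [← Cardinal.mk_image_eq_of_injOn _ _ hinj]
      refine Cardinal.mk_le_mk_of_subset ?_
      rintro _ ⟨ξ, hξ, rfl⟩
      exact hξ.2
    obtain ⟨k, hk⟩ := hK.exists_gt (⋃ η ∈ s, (N η) '' s)
      (mk_biUnion_lt_of_isRegular hK.isRegular hs fun η _ => mk_image_lt hs _)
    refine ⟨max k (e β α), mem_treeBelow.2 ⟨α, hα, le_max_right _ _, ?_, Or.inl rfl⟩⟩
    intro η ζ hζ hη h1 h2
    refine treeBelow_mono ?_ ζ (hN η ζ hζ hη)
    refine le_max_of_le_left (hk _ ?_).le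
    simp only [mem_iUnion]
    exact ⟨η, ⟨hη.trans hζ, h1⟩, ζ, ⟨hζ, h2⟩, rfl⟩

/-- A function on the pairs from `W` which is subadditive in both senses, with small sublevels. -/
structure IsSubadditive (κ : Cardinal.{u}) (v : W → W → K) : Prop where
  le_max : ∀ {α β γ}, α < β → β < γ → v α γ ≤ max (v α β) (v β γ)
  le_max' : ∀ {α β γ}, α < β → β < γ → v α β ≤ max (v α γ) (v β γ)
  mk_lt : ∀ β ν, #{α | α < β ∧ v α β ≤ ν} < κ

theorem exists_isSubadditive [WellFoundedLT K] (hK : HasRegularType κ K)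
    (hW : HasRegularType (Order.succ κ) W) : ∃ v : W → W → K, IsSubadditive κ v := by
  have : ∀ β : W, ∃ e : W → K, InjOn e (Iio β) := by
    intro β
    have h := Order.lt_succ_iff.1 (hW.mk_Iio_lt β)
    rw [← hK.mk_eq] at h
    obtain ⟨g⟩ := h
    have : Nonempty K := Cardinal.mk_ne_zero_iff.1 (hK.mk_eq ▸ hK.isRegular.pos.ne')
    classical
    refine ⟨fun x => if hx : x < β then g ⟨x, hx⟩ else Classical.arbitrary K, ?_⟩
    intro x hx y hy hxy
    simp only [mem_Iio] at hx hy
    simp only [hx, hy, dif_pos] at hxy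
    exact congrArg Subtype.val (g.injective hxy)
  choose e he using this
  -- `v α β` is the least index of a tree order that puts `α` below `β`.
  have : ∀ α β, ∃ ν, α < β → ∀ ν', ν ≤ ν' ↔ α ∈ treeBelow e β ν' := by
    intro α β
    by_cases h : α < β
    · have hne : {ν | α ∈ treeBelow e β ν}.Nonempty := exists_mem_treeBelow hK he h
      refine ⟨WellFounded.min wellFounded_lt _ hne, fun _ ν' => ⟨fun h1 => ?_, fun h1 => ?_⟩⟩
      · exact treeBelow_mono h1 β (WellFounded.min_mem wellFounded_lt _ hne)
      · exact WellFounded.min_le (s := {ν | α ∈ treeBelow e β ν}) wellFounded_lt h1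
    · exact ⟨e α β, fun h' => absurd h' h⟩
  choose v hv using this
  refine ⟨v, ⟨fun {α β γ} h1 h2 => ?_, fun {α β γ} h1 h2 => ?_, fun β ν => ?_⟩⟩
  · rw [hv _ _ (h1.trans h2)]
    have hβ := (hv _ _ h2 _).1 (le_max_right (v α β) (v β γ))
    exact (mem_treeBelow_iff_of_mem hβ h1).2 ((hv _ _ h1 _).1 (le_max_left _ _))
  · rw [hv _ _ h1]
    have hβ := (hv _ _ h2 _).1 (le_max_right (v α γ) (v β γ))
    exact (mem_treeBelow_iff_of_mem hβ h1).1 ((hv _ _ (h1.trans h2) _).1 (le_max_left _ _))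
  · refine mk_lt_of_subset ?_ (mk_treeBelow_lt hK he ν β)
    rintro α ⟨h1, h2⟩
    exact (hv _ _ h1 _).1 h2

end Subadditive

/-! ### The graph: no 4-cliques, and an edge in every large family of columns -/

section Guess

variable {κ : Cardinal.{u}} {K W : Type u} [LinearOrder K] [LinearOrder W] [WellFoundedLT W]

/-- The heights in the column `a` to which a point at height `b` is joined: those below a bound
given by the functions `f j` with `v j b ≤ v a b`, except for the heights which would join two
points of the neighbourhood in the wrong order. -/
def guess {K W : Type u} [LinearOrder K] [LinearOrder W] [WellFoundedLT W]
    (v : W → W → K) (f : W → K → K) (bd : Set K → K) (b a : W) : Set W :=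
  {x | a < x ∧ x < b ∧ ∃ T : Set W,
    T = {y | ∃ a', ∃ _ : a' < a, v a' b ≤ v a b ∧
      ∃ b', ∃ _ : b' < b, b' ∈ guess v f bd b a' ∧ y ∈ guess v f bd b' a} ∧
    x ∉ T ∧ ∃ j < b, v j b ≤ v a b ∧
      v x b ≤ f j (max (v a b) (bd ((fun y => v y b) '' T)))}
termination_by (wellFounded_lt (α := W ×ₗ W)).wrap (toLex (b, a))
decreasing_by
  · exact Prod.Lex.toLex_lt_toLex.2 (Or.inr ⟨rfl, by assumption⟩)
  · exact Prod.Lex.toLex_lt_toLex.2 (Or.inl (by assumption))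

/-- The heights in the column `a` removed from `guess v f bd b a`. -/
def avoided (v : W → W → K) (f : W → K → K) (bd : Set K → K) (b a : W) : Set W :=
  {y | ∃ a' < a, v a' b ≤ v a b ∧ ∃ b' < b, b' ∈ guess v f bd b a' ∧ y ∈ guess v f bd b' a}

variable {v : W → W → K} {f : W → K → K} {bd : Set K → K}

theorem mem_guess {b a x : W} : x ∈ guess v f bd b a ↔ a < x ∧ x < b ∧ x ∉ avoided v f bd b a ∧
    ∃ j < b, v j b ≤ v a b ∧
      v x b ≤ f j (max (v a b) (bd ((fun y => v y b) '' avoided v f bd b a))) := by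
  rw [guess]
  simp only [mem_ofPred_eq, exists_prop, exists_eq_left, avoided]

theorem IsSubadditive.mk_guess_lt (hv : IsSubadditive κ v) (hκ : κ.IsRegular) (b a : W) :
    #(guess v f bd b a) < κ := by
  refine mk_lt_of_subset (t := ⋃ j ∈ {j | j < b ∧ v j b ≤ v a b}, {x | x < b ∧
    v x b ≤ f j (max (v a b) (bd ((fun y => v y b) '' avoided v f bd b a)))}) ?_
    (mk_biUnion_lt_of_isRegular hκ (hv.mk_lt b _) fun j _ => hv.mk_lt b _)
  intro x hx
  obtain ⟨-, h1, -, j, h2, h3, h4⟩ := mem_guess.1 hx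
  simp only [mem_iUnion]
  exact ⟨j, ⟨h2, h3⟩, h1, h4⟩

theorem IsSubadditive.mk_avoided_lt (hv : IsSubadditive κ v) (hκ : κ.IsRegular) {b a : W}
    (hab : a < b) : #(avoided v f bd b a) < κ := by
  refine mk_lt_of_subset (t := ⋃ a' ∈ {x | x < b ∧ v x b ≤ v a b},
    ⋃ b' ∈ guess v f bd b a', guess v f bd b' a) ?_
    (mk_biUnion_lt_of_isRegular hκ (hv.mk_lt b _) fun a' _ =>
      mk_biUnion_lt_of_isRegular hκ (hv.mk_guess_lt hκ _ _) fun b' _ => hv.mk_guess_lt hκ _ _)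
  rintro x ⟨a', h1, h2, b', -, h3, h4⟩
  simp only [mem_iUnion]
  exact ⟨a', ⟨h1.trans hab, h2⟩, b', h3, h4⟩

/-- The oriented edges of a graph on `W × W`. -/
def ScaleEdge (v : W → W → K) (f : W → K → K) (bd : Set K → K) (p q : W × W) : Prop :=
  p.1 < q.1 ∧ v p.1 p.2 < v q.1 p.2 ∧ q.2 ∈ guess v f bd p.2 q.1

theorem IsSubadditive.triangle (hv : IsSubadditive κ v) {p q r : W × W}
    (hpq : ScaleEdge v f bd p q) (hpr : ScaleEdge v f bd p r) (hqr : ScaleEdge v f bd q r) :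
    v r.1 p.2 < v q.1 p.2 ∧ v q.1 r.1 = v q.1 p.2 ∧ v p.1 r.1 < v q.1 r.1 := by
  obtain ⟨h1, -, h2⟩ := hpq
  obtain ⟨h3, h4, h5⟩ := hpr
  obtain ⟨h6, -, h7⟩ := hqr
  obtain ⟨h8, h9, -⟩ := mem_guess.1 h2
  obtain ⟨h10, h11, h12, -⟩ := mem_guess.1 h5
  have hlt : v r.1 p.2 < v q.1 p.2 := by
    -- Otherwise `q` witnesses that `r.2` was removed from the neighbourhood of `p` in column `r.1`.
    by_contra! h
    exact h12 ⟨q.1, h6, h, q.2, h9, h2, h7⟩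
  have hr : r.1 < p.2 := h10.trans h11
  have heq : v q.1 r.1 = v q.1 p.2 := by
    apply le_antisymm
    · exact (hv.le_max' h6 hr).trans (max_le le_rfl hlt.le)
    · exact (le_max_iff.1 (hv.le_max h6 hr)).resolve_right (not_le.2 hlt)
  refine ⟨hlt, heq, heq ▸ ?_⟩
  exact (hv.le_max' h3 hr).trans_lt (max_lt (h4.trans hlt) hlt)

/-- The triangle `p, q, r` makes `v · p.2` drop from `q.1` to `r.1`. The triangles through `p` and
`s` turn these values into `v q.1 s.1` and `v r.1 s.1`, which the triangle `q, r, s` orders the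
other way. -/
theorem IsSubadditive.not_clique_four (hv : IsSubadditive κ v) {p q r s : W × W}
    (hpq : ScaleEdge v f bd p q) (hpr : ScaleEdge v f bd p r) (hps : ScaleEdge v f bd p s)
    (hqr : ScaleEdge v f bd q r) (hqs : ScaleEdge v f bd q s) (hrs : ScaleEdge v f bd r s) :
    False := by
  have h1 := (hv.triangle hpq hps hqs).2.1
  have h2 := (hv.triangle hpr hps hrs).2.1
  have h3 := (hv.triangle hpq hpr hqr).1
  have h4 := (hv.triangle hqr hqs hrs).2.2
  rw [h1, h2] at h4
  exact lt_asymm h3 h4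

theorem IsSubadditive.exists_scaleEdge (hv : IsSubadditive κ v) (hK : HasRegularType κ K)
    (hW : HasRegularType (Order.succ κ) W) (hbd : ∀ s : Set K, #s < κ → ∀ x ∈ s, x < bd s)
    (hf : ∀ h : K → K, ∃ j, #{ξ | f j ξ < h ξ} < κ) {A : Set W} (hA : #A = κ) {Y : W → Set W}
    (hY : ∀ a ∈ A, κ < #(Y a)) :
    ∃ a ∈ A, ∃ b ∈ Y a, ∃ a' ∈ A, ∃ b' ∈ Y a', ScaleEdge v f bd (a, b) (a', b') := by
  have hκ := hK.isRegular
  have hsucc : κ < Order.succ κ := Order.lt_succ κ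
  obtain ⟨δ, hδ⟩ := hW.exists_gt A (hA ▸ hsucc)
  have : ∀ a, ∃ Z : Set W, a ∈ A → Z ⊆ Y a ∧ (∀ x ∈ Z, δ < x) ∧ #Z = κ := by
    intro a
    by_cases ha : a ∈ A
    · have h1 : κ ≤ #(Y a \ Iic δ : Set W) := by
        by_contra! h
        have h2 : #(Iic δ ∪ (Y a \ Iic δ) : Set W) < Order.succ κ :=
          mk_union_lt_of_isRegular hW.isRegular (hW.mk_Iic_lt δ) (h.trans hsucc)
        rw [union_sdiff_self] at h2
        have h3 := mk_lt_of_subset (subset_union_right (s := Iic δ) (t := Y a)) h2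
        exact absurd (hY a ha) (not_lt.2 (Order.lt_succ_iff.1 h3))
      obtain ⟨Z, hZ, hZκ⟩ := Cardinal.le_mk_iff_exists_subset.1 h1
      exact ⟨Z, fun _ => ⟨fun x hx => (hZ hx).1, fun x hx => not_le.1 (hZ hx).2, hZκ⟩⟩
    · exact ⟨∅, fun h => absurd h ha⟩
  choose Z hZY hZδ hZκ using this
  obtain ⟨d, hd⟩ := hW.exists_gt ((⋃ a ∈ A, Z a) ∪ {δ}) (mk_union_lt_of_isRegular hW.isRegular
    (mk_biUnion_lt_of_isRegular hW.isRegular (hA ▸ hsucc) fun a ha => (hZκ a ha).trans_lt hsucc)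
    (mk_singleton_lt_of_isRegular hW.isRegular δ))
  have hZd : ∀ a ∈ A, ∀ x ∈ Z a, x < d := fun a ha x hx =>
    hd x (Or.inl (mem_biUnion ha hx))
  have hAd : ∀ a ∈ A, a < d := fun a ha => (hδ a ha).trans (hd δ (Or.inr rfl))
  -- The function to be dominated: fewer than `κ` columns have `v a d ≤ t`, so one bound `m` covers
  -- a point with value above `t` from each.
  have : ∀ t, ∃ m, ∀ a ∈ A, v a d ≤ t → ∃ b' ∈ Z a, t < v b' d ∧ v b' d ≤ m := by
    intro t
    have h1 : ∀ a, ∃ b', a ∈ A → b' ∈ Z a ∧ t < v b' d := by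
      intro a
      by_cases ha : a ∈ A
      · obtain ⟨x, hx, hx'⟩ := exists_mem_notMem_of_mk_lt (hv.mk_lt d t) (hZκ a ha).ge
        exact ⟨x, fun _ => ⟨hx, not_le.1 fun h => hx' ⟨hZd a ha x hx, h⟩⟩⟩
      · exact ⟨a, fun h => absurd h ha⟩
    choose B hB using h1
    obtain ⟨m, hm⟩ := hK.exists_gt ((fun a => v (B a) d) '' {a | a < d ∧ v a d ≤ t})
      (mk_image_lt (hv.mk_lt d t) _)
    exact ⟨m, fun a ha hat => ⟨B a, (hB a ha).1, (hB a ha).2, (hm _ ⟨a, ⟨hAd a ha, hat⟩, rfl⟩).le⟩⟩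
  choose h hh using this
  obtain ⟨j, hj⟩ := hf h
  obtain ⟨t₀, ht₀⟩ := hK.exists_gt _ hj
  have hdom : ∀ t, t₀ ≤ t → h t ≤ f j t := fun t ht => not_lt.1 fun h' => absurd (ht₀ t h') ht.not_gt
  have hne : A.Nonempty := by
    rw [← Set.nonempty_coe_sort, ← Cardinal.mk_ne_zero_iff, hA]
    exact hκ.pos.ne'
  obtain ⟨a, ha, hmin⟩ : ∃ a ∈ A, ∀ x ∈ A, a ≤ x :=
    ⟨_, WellFounded.min_mem wellFounded_lt A hne, fun x hx => WellFounded.min_le wellFounded_lt hx⟩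
  -- `b` lies above `j`, so that `f j` is available to it, and above `d`, so that `v · d` and `v ·
  -- b` agree at large values.
  obtain ⟨b, hb, hb'⟩ := exists_mem_notMem_of_mk_lt (hW.mk_Iic_lt (max d j))
    (Order.succ_le_of_lt (hY a ha))
  obtain ⟨hdb, hjb⟩ := max_lt_iff.1 (not_le.1 hb')
  obtain ⟨a', ha', hna'⟩ := exists_mem_notMem_of_mk_lt
    (mk_union_lt_of_isRegular hκ
      (hv.mk_lt d (max (max (v d b) t₀) (max (v j b) (v a b)))) (mk_singleton_lt_of_isRegular hκ a))
    hA.ge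
  have haa' : a < a' := lt_of_le_of_ne (hmin a' ha') fun h => hna' (Or.inr h.symm)
  have hbig : max (max (v d b) t₀) (max (v j b) (v a b)) < v a' d :=
    not_le.1 fun h => hna' (Or.inl ⟨hAd a' ha', h⟩)
  simp only [max_lt_iff] at hbig
  obtain ⟨⟨h1, h2⟩, h3, h4⟩ := hbig
  have heq : ∀ x < d, v d b < v x d → v x b = v x d := fun x hx hlt =>
    le_antisymm ((hv.le_max hx hdb).trans (max_le le_rfl hlt.le))
      ((le_max_iff.1 (hv.le_max' hx hdb)).resolve_right (not_le.2 hlt))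
  have hμ := heq a' (hAd a' ha') h1
  have hT := hv.mk_avoided_lt (f := f) (bd := bd) hκ ((hAd a' ha').trans hdb)
  set t := bd ((fun y => v y b) '' avoided v f bd b a') with ht
  -- Exceeding `t` keeps `b'` out of the removed set; exceeding `v a' d` lets its value be
  -- transferred from `d` to `b`.
  obtain ⟨b', hb', h5, h6⟩ := hh (max (v a' d) t) a' ha' (le_max_left _ _)
  have hb'd := hZd a' ha' b' hb'
  have hν := heq b' hb'd (h1.trans ((le_max_left _ _).trans_lt h5))
  refine ⟨a, ha, b, hb, a', ha', b', hZY a' ha' hb', haa', hμ ▸ h4, mem_guess.2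
    ⟨(hδ a' ha').trans (hZδ a' ha' b' hb'), hb'd.trans hdb, fun hmem => ?_, j, hjb, hμ ▸ h3.le, ?_⟩⟩
  · have h7 : v b' b < t := hbd _ (mk_image_lt hT _) _ ⟨b', hmem, rfl⟩
    rw [hν] at h7
    exact absurd ((le_max_right _ _).trans_lt h5) h7.not_gt
  · rw [← ht, hν, hμ]
    exact h6.trans (hdom _ (h2.le.trans (le_max_left _ _)))

end Guess

/-! ### Finding many full columns in a set of type `λκ` -/

section Columns

variable {κ : Cardinal.{u}} {K W : Type u} [LinearOrder K] [LinearOrder W]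

theorem exists_mem_mk_fiber_lt {α β : Type u} (hκ : κ.IsRegular) {s : Set α} (hs : κ ≤ #s)
    {t : Set β} (ht : #t < κ) (f : α → β) (hf : ∀ x ∈ s, f x ∈ t) :
    ∃ y ∈ t, κ ≤ #{x | x ∈ s ∧ f x = y} := by
  by_contra! h
  have h1 := mk_biUnion_lt_of_isRegular hκ ht h
  refine absurd (mk_lt_of_subset (fun x hx => ?_) h1) (not_lt.2 hs)
  exact mem_biUnion (hf x hx) ⟨hx, rfl⟩

/-- A copy of the product order `K × W` in boundedly many copies of `W × W` has `κ` many columns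
of full size in one of the copies. -/
theorem exists_columns (hK : HasRegularType κ K) (hW : HasRegularType (Order.succ κ) W)
    (g : K → W → K × W × W)
    (hg : ∀ i j x y, Prod.Lex (· < ·) (· < ·) (i, x) (j, y) →
      Prod.Lex (· < ·) (Prod.Lex (· < ·) (· < ·)) (g i x) (g j y))
    (k₀ : K) (hk₀ : ∀ i x, (g i x).1 ≤ k₀) :
    ∃ k, ∃ A : Set W, #A = κ ∧ ∀ a ∈ A, κ < #{b | ∃ i x, g i x = (k, a, b)} := by
  have hκ := hK.isRegular
  have hWκ := hW.isRegular
  have hsucc : κ < Order.succ κ := Order.lt_succ κ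
  have h1 : ∀ i, ∃ k ∈ Iic k₀, Order.succ κ ≤ #{x | x ∈ univ ∧ (g i x).1 = k} := fun i =>
    exists_mem_mk_fiber_lt hWκ (by rw [Cardinal.mk_univ, hW.mk_eq])
      ((hK.mk_Iic_lt k₀).trans hsucc) _ fun x _ => hk₀ i x
  simp only [mem_univ, true_and] at h1
  choose k hk hk' using h1
  obtain ⟨c, -, hc⟩ := exists_mem_mk_fiber_lt hκ (s := univ) (by rw [Cardinal.mk_univ, hK.mk_eq])
    (hK.mk_Iic_lt k₀) k fun i _ => hk i
  simp only [mem_univ, true_and] at hc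
  have h2 : ∀ i, ∃ a, k i = c → Order.succ κ ≤ #{x | (g i x).1 = c ∧ (g i x).2.1 = a} := by
    intro i
    obtain ⟨x₀⟩ : Nonempty W := Cardinal.mk_ne_zero_iff.1 (hW.mk_eq ▸ hWκ.pos.ne')
    by_cases hi : k i = c
    · obtain ⟨j, hj, hij⟩ := exists_mem_notMem_of_mk_lt (hK.mk_Iic_lt i) hc
      have hne : {x | (g j x).1 = k j}.Nonempty := by
        rw [← Set.nonempty_coe_sort, ← Cardinal.mk_ne_zero_iff]
        exact (hWκ.pos.trans_le (hk' j)).ne'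
      obtain ⟨y, hy⟩ := hne
      obtain ⟨a, -, ha⟩ := exists_mem_mk_fiber_lt hWκ (hk' i) (hW.mk_Iic_lt (g j y).2.1)
        (fun x => (g i x).2.1) (fun x hx => by
          have h := hg i j x y (Prod.Lex.left _ _ (not_le.1 hij))
          have hx' : (g i x).1 = (g j y).1 := by
            rw [show (g i x).1 = k i from hx, show (g j y).1 = k j from hy, hi]; exact hj.symm
          rcases Prod.lex_def.1 h with h | ⟨-, h⟩
          · exact absurd hx' h.ne
          · rcases Prod.lex_def.1 h with h | ⟨h, -⟩
            · exact h.le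
            · exact h.le)
      refine ⟨a, fun _ => ?_⟩
      rw [hi] at ha
      exact ha
    · exact ⟨x₀, fun h => absurd h hi⟩
  choose a ha using h2
  have hlt : ∀ i j x y b, (i < j ∨ i = j ∧ x < y) → (g i x).1 = c → (g i x).2.1 = b →
      (g j y).1 = c → (g j y).2.1 = b → (g i x).2.2 < (g j y).2.2 := by
    intro i j x y b hij h1 h2 h3 h4
    have h := hg i j x y (Prod.lex_def.2 hij)
    rcases Prod.lex_def.1 h with h | ⟨-, h⟩
    · exact absurd (h1.trans h3.symm) h.ne
    · rcases Prod.lex_def.1 h with h | ⟨-, h⟩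
      · exact absurd (h2.trans h4.symm) h.ne
      · exact h
  have hinj : ∀ i b, InjOn (fun x => (g i x).2.2) {x | (g i x).1 = c ∧ (g i x).2.1 = b} := by
    intro i b x hx y hy hxy
    rcases lt_trichotomy x y with h | h | h
    · exact absurd hxy (hlt i i x y b (Or.inr ⟨rfl, h⟩) hx.1 hx.2 hy.1 hy.2).ne
    · exact h
    · exact absurd hxy (hlt i i y x b (Or.inr ⟨rfl, h⟩) hy.1 hy.2 hx.1 hx.2).ne'
  -- If two blocks shared a column, one point of the later block would bound the `λ` heights of the
  -- earlier one.
  have hanti : ∀ i j, k i = c → k j = c → i < j → a i ≠ a j := by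
    intro i j hi hj hij heq
    have hne : {x | (g j x).1 = c ∧ (g j x).2.1 = a j}.Nonempty := by
      rw [← Set.nonempty_coe_sort, ← Cardinal.mk_ne_zero_iff]
      exact (hWκ.pos.trans_le (ha j hj)).ne'
    obtain ⟨y, hy⟩ := hne
    have h3 := ha i hi
    rw [← Cardinal.mk_image_eq_of_injOn _ _ (hinj i (a i))] at h3
    refine absurd (mk_lt_of_subset ?_ (hW.mk_Iio_lt (g j y).2.2)) (not_lt.2 h3)
    rintro _ ⟨x, hx, rfl⟩
    exact hlt i j x y (a j) (Or.inl hij) hx.1 (hx.2.trans heq) hy.1 hy.2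
  refine ⟨c, a '' {i | k i = c}, ?_, ?_⟩
  · rw [Cardinal.mk_image_eq_of_injOn]
    · exact le_antisymm (hK.mk_eq ▸ Cardinal.mk_set_le _) hc
    · intro i hi j hj hij
      rcases lt_trichotomy i j with h | h | h
      · exact absurd hij (hanti i j hi hj h)
      · exact h
      · exact absurd hij.symm (hanti j i hj hi h)
  · rintro _ ⟨i, hi, rfl⟩
    have h3 := ha i hi
    rw [← Cardinal.mk_image_eq_of_injOn _ _ (hinj i (a i))] at h3
    refine (hsucc.trans_le h3).trans_le (Cardinal.mk_le_mk_of_subset ?_)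
    rintro _ ⟨x, hx, rfl⟩
    refine ⟨i, x, ?_⟩
    ext
    · exact hx.1
    · exact hx.2
    · rfl

end Columns

theorem exists_dominating_enumeration {κ lam : Cardinal.{u}} (hlam : lam ≠ 0)
    (hd : lam = dominatingNumber κ) : ∃ f : lam.ord.ToType → κ.ord.ToType → κ.ord.ToType,
    ∀ h : κ.ord.ToType → κ.ord.ToType, ∃ j, #{ξ | f j ξ < h ξ} < κ := by
  have hne : {c : Cardinal.{u} | ∃ A : Set (κ.ord.ToType → κ.ord.ToType), #A = c ∧
    ∀ f : κ.ord.ToType → κ.ord.ToType, ∃ g ∈ A, #{ξ : κ.ord.ToType | g ξ < f ξ} < κ}.Nonempty := by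
    by_contra h
    rw [Set.not_nonempty_iff_eq_empty] at h
    rw [dominatingNumber, h, Cardinal.sInf_empty] at hd
    exact hlam hd
  obtain ⟨A, hA, hdom⟩ := csInf_mem hne
  have hA' : #lam.ord.ToType = #A := by
    rw [hA]; simpa [dominatingNumber] using hd
  obtain ⟨e⟩ := Cardinal.eq.1 hA'
  refine ⟨fun j => (e j).1, fun h => ?_⟩
  obtain ⟨g, hg, hgh⟩ := hdom h
  exact ⟨e.symm ⟨g, hg⟩, by simpa using hgh⟩

/-! ### From graphs to colourings, and the final assembly -/

section Partition

variable {W : Type u} [LinearOrder W] [WellFoundedLT W]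

theorem pair_mem_subsetsOfType {X : Set W} {x y : W} (hx : x ∈ X) (hy : y ∈ X) (hxy : x < y) :
    {x, y} ∈ subsetsOfType X 2 := by
  refine ⟨pair_subset hx hy, ?_⟩
  rw [Ordinal.type_fintype, ← Nat.card_eq_fintype_card]
  simp [hxy.ne]

/-- The colouring of pairs which takes the value `1` on `{x < y}` if and only if `E x y`. -/
noncomputable def colouringOfRel (E : W → W → Prop) (s : subsetsOfType (univ : Set W) 2) : Fin 2 :=
  open Classical in if ∃ x ∈ s.1, ∃ y ∈ s.1, x < y ∧ E x y then 1 else 0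

theorem colouringOfRel_pair {E : W → W → Prop} {x y : W} (hxy : x < y) :
    colouringOfRel E ⟨{x, y}, pair_mem_subsetsOfType (mem_univ x) (mem_univ y) hxy⟩ = 1 ↔
      E x y := by
  simp only [colouringOfRel]
  constructor
  · intro h
    split_ifs at h with h'
    swap
    · exact absurd h (by decide)
    obtain ⟨a, ha, b, hb, hab, hE⟩ := h'
    rcases ha with rfl | rfl <;> rcases hb with rfl | rfl
    · exact absurd hab (lt_irrefl _)
    · exact hE
    · exact absurd hab hxy.not_gt
    · exact absurd hab (lt_irrefl _)
  · intro h
    rw [if_pos ⟨x, by simp, y, by simp, hxy, h⟩]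

end Partition

/-- A relation with no clique of four points which holds for some pair in each set of type `β`
is a counterexample to `α → (β, 4)²`. -/
theorem not_partitionArrow_of_rel {α β : Ordinal.{u}} (E : α.ToType → α.ToType → Prop)
    (h4 : ∀ x y z w, E x y → E x z → E x w → E y z → E y w → E z w → False)
    (hβ : ∀ X : Set α.ToType, typeLT X = β → ∃ x ∈ X, ∃ y ∈ X, x < y ∧ E x y) :
    ¬ PartitionArrow α ![β, 4] 2 := by
  intro h
  obtain ⟨i, X, ⟨-, hX⟩, hs⟩ := h (colouringOfRel E)
  have key : ∀ x ∈ X, ∀ y ∈ X, x < y → (E x y ↔ i = 1) := by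
    intro x hx y hy hxy
    rw [← colouringOfRel_pair (E := E) hxy, hs _ (pair_mem_subsetsOfType hx hy hxy)]
  fin_cases i
  · obtain ⟨x, hx, y, hy, hxy, hE⟩ := hβ X hX
    exact absurd ((key x hx y hy hxy).1 hE) (by simp)
  · have hX4 : #X = (4 : ℕ) := by
      rw [← Ordinal.card_type ((· < ·) : X → X → Prop), hX]; simp
    have : Finite X := Cardinal.lt_aleph0_iff_finite.1 (hX4 ▸ Cardinal.natCast_lt_aleph0)
    have : Fintype X := Fintype.ofFinite X
    rw [Cardinal.mk_fintype, Nat.cast_inj] at hX4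
    let r : Fin 4 ≃o X := Fintype.orderIsoFinOfCardEq X hX4
    have key' : ∀ a b : Fin 4, a < b → E (r a) (r b) := fun a b hab =>
      (key _ (r a).2 _ (r b).2 (r.lt_iff_lt.2 hab)).2 rfl
    exact h4 _ _ _ _ (key' 0 1 (by decide)) (key' 0 2 (by decide)) (key' 0 3 (by decide))
      (key' 1 2 (by decide)) (key' 1 3 (by decide)) (key' 2 3 (by decide))

theorem mainTheorem10 (κ lam : Cardinal.{u}) (hκ : κ.IsRegular)
    (hlam : lam = Order.succ κ) (hd : lam = dominatingNumber κ)
    (α : Ordinal.{u}) (hα : α < lam.ord ^ 2 * κ.ord) :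
    ¬ PartitionArrow α ![lam.ord * κ.ord, 4] 2 := by
  have hlamr : lam.IsRegular := hlam ▸ Cardinal.isRegular_succ hκ.aleph0_le
  have hK := hasRegularType_toType hκ
  have hW : HasRegularType (Order.succ κ) lam.ord.ToType := hlam ▸ hasRegularType_toType hlamr
  obtain ⟨f, hf⟩ := exists_dominating_enumeration hlamr.pos.ne' hd
  obtain ⟨v, hv⟩ := exists_isSubadditive hK hW
  have : ∀ s : Set κ.ord.ToType, ∃ k, #s < κ → ∀ x ∈ s, x < k := by
    intro s
    by_cases hs : #s < κ
    · obtain ⟨k, hk⟩ := hK.exists_gt s hs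
      exact ⟨k, fun _ => hk⟩
    · obtain ⟨k⟩ : Nonempty κ.ord.ToType :=
        Cardinal.mk_ne_zero_iff.1 (by rw [hK.mk_eq]; exact hκ.pos.ne')
      exact ⟨k, fun h => absurd h hs⟩
  choose bd hbd using this
  have hα' : typeLT α.ToType < Ordinal.type (Prod.Lex ((· < ·) : κ.ord.ToType → _ → Prop)
      (Prod.Lex ((· < ·) : lam.ord.ToType → _ → Prop)
        ((· < ·) : lam.ord.ToType → _ → Prop))) := by
    rw [Ordinal.type_prod_lex, Ordinal.type_prod_lex]
    simpa [sq] using hα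
  obtain ⟨π⟩ := Ordinal.type_lt_iff.1 hα'
  -- The embedding is onto a proper initial segment, so its top bounds the copies used.
  have hπ : ∀ x, (π x).1 ≤ π.top.1 := by
    intro x
    rcases Prod.lex_def.1 (π.lt_top x) with h | ⟨h, -⟩
    · exact h.le
    · exact h.le
  refine not_partitionArrow_of_rel
    (fun x y => (π x).1 = (π y).1 ∧ ScaleEdge v f bd (π x).2 (π y).2) ?_ ?_
  · intro x y z w h1 h2 h3 h4 h5 h6
    exact hv.not_clique_four h1.2 h2.2 h3.2 h4.2 h5.2 h6.2
  · intro X hX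
    have hX' : typeLT X = Ordinal.type (Prod.Lex ((· < ·) : κ.ord.ToType → _ → Prop)
        ((· < ·) : lam.ord.ToType → _ → Prop)) := by
      rw [hX, Ordinal.type_prod_lex]; simp
    obtain ⟨r⟩ := Ordinal.type_eq.1 hX'
    obtain ⟨k, A, hA, hY⟩ := exists_columns hK hW (fun i x => π (r.symm (i, x)))
      (fun i j x y h => π.map_rel_iff.2 (r.symm.map_rel_iff.2 h)) π.top.1 fun i x => hπ _
    obtain ⟨a, ha, b, ⟨i, x, hx⟩, a', ha', b', ⟨j, y, hy⟩, hE⟩ :=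
      hv.exists_scaleEdge hK hW hbd hf hA hY
    refine ⟨_, (r.symm (i, x)).2, _, (r.symm (j, y)).2, ?_, ?_⟩
    · refine π.map_rel_iff.1 ?_
      rw [hx, hy]
      exact Prod.Lex.right _ (Prod.Lex.left _ _ hE.1)
    · rw [hx, hy]
      exact ⟨rfl, hE⟩
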